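/- Let $E$ be an elliptic curve over $\mathbb{Q}$ (a nonsingular Weierstrass curve $y^2+a_1xy+a_3y=x^3+a_2x^2+a_4x+a_6$ with coefficients in $\mathbb{Q}$, together with the point $\mathcal{O}$ at infinity), let $K$ be an algebraically closed field containing $\mathbb{Q}$ (for instance $\overline{\mathbb{Q}}$ or $\mathbb{C}$), and let $\ell$ be a prime. For $m\ge 1$ write $E[m]=\{Q\in E(K): mQ=\mathcal{O}\}$, which is a $\mathbb{Z}/m\mathbb{Z}$-module. Let $$\operatorname{Tate}_\ell(E)=\varprojlim_n E[\ell^n]=\{(P_n)_{n\ge 1} : P_n\in E[\ell^n],\ \ell P_{n+1}=P_n \text{ for all } n\ge 1\},$$ regarded as a module over $\mathbb{Z}_\ell=\varprojlim_n\mathbb{Z}/\ell^n\mathbb{Z}$ by $(a_n)_n\cdot(P_n)_n=(a_nP_n)_n$. Then $$\operatorname{Tate}_\ell(E)\cong\mathbb{Z}_\ell\oplus\mathbb{Z}_\ell$$ as $\mathbb{Z}_\ell$-modules; that is, $\operatorname{Tate}_\ell(E)$ is a free $\mathbb{Z}_\ell$-module of rank $2$. Moreover, let $(A_n)_{n\in\mathbb{N}}$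 and $(B_n)_{n\in\mathbb{N}}$ be any inverse systems of abelian groups with transition homomorphisms $\varphi^A_n:A_{n+1}\to A_n$ and $\varphi^B_n:B_{n+1}\to B_n$, and give $(A_n\oplus B_n)_n$ the componentwise transition maps $\varphi_n(a,b)=(\varphi^A_n(a),\varphi^B_n(b))$. Then the map $(a_n,b_n)_n\mapsto((a_n)_n,(b_n)_n)$ is an isomorphism of groups $$\varprojlim (A_n\oplus B_n)\cong\Big(\varprojlim A_n\Big)\oplus\Big(\varprojlim B_n\Big).$$ -/

import Mathlib

/-- The inverse limit of a sequence of abelian groups `A 0 ← A 1 ← A 2 ← ⋯` with transition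
homomorphisms `φ n : A (n + 1) → A n`: the subgroup of compatible families in `∏ n, A n`. -/
def inverseLimit {A : ℕ → Type*} [∀ n, AddCommGroup (A n)] (φ : ∀ n, A (n + 1) →+ A n) :
    AddSubgroup (∀ n, A n) where
  carrier := {a | ∀ n, φ n (a (n + 1)) = a n}
  zero_mem' := fun n => by simp
  add_mem' := fun {a b} ha hb n => by
    have h1 := ha n
    have h2 := hb n
    simp [h1, h2]
  neg_mem' := fun {a} ha n => by
    have h1 := ha n
    simp [h1]

/-- The `ℓ ^ n`-torsion subgroup `A[ℓ ^ n]` of an abelian group `A`. -/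
abbrev primePowerTorsion (ℓ : ℕ) (A : Type*) [AddCommGroup A] (n : ℕ) : AddSubgroup A :=
  AddSubgroup.torsionBy A ((ℓ ^ n : ℕ) : ℤ)

/-- The `ℤ/ℓ ^ n`-module structure of `A[ℓ ^ n]`: the class of an integer `k` acts as
multiplication by `k`. -/
@[reducible] noncomputable def primePowerTorsionModule (ℓ : ℕ) (A : Type*) [AddCommGroup A]
    (n : ℕ) : Module (ZMod (ℓ ^ n)) (primePowerTorsion ℓ A n) :=
  AddSubgroup.torsionBy.zmodModule

/-- Multiplication by `ℓ` as a homomorphism `A[ℓ ^ (n + 1)] → A[ℓ ^ n]`. -/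
def torsionTransition (ℓ : ℕ) (A : Type*) [AddCommGroup A] (n : ℕ) :
    primePowerTorsion ℓ A (n + 1) →+ primePowerTorsion ℓ A n where
  toFun P := ⟨ℓ • (P : A), by
    have h := AddSubgroup.torsionBy.nsmul_iff.mp P.2
    rw [AddSubgroup.torsionBy.nsmul_iff, smul_smul, ← pow_succ]
    exact h⟩
  map_zero' := by ext; simp
  map_add' P Q := by ext; simp

/-- The `ℓ`-adic Tate module of an abelian group `A`, the inverse limit of the groups `A[ℓ ^ n]`,
`n ≥ 1`, under multiplication by `ℓ`. The component with index `n : ℕ` lies in `A[ℓ ^ (n + 1)]`. -/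
def TateModule (ℓ : ℕ) (A : Type*) [AddCommGroup A] : Type _ :=
  inverseLimit (A := fun n => primePowerTorsion ℓ A (n + 1))
    (fun n => torsionTransition ℓ A (n + 1))

namespace TateModule

variable (ℓ : ℕ) (A : Type*) [AddCommGroup A]

instance instAddCommGroup : AddCommGroup (TateModule ℓ A) :=
  inferInstanceAs (AddCommGroup (inverseLimit (A := fun n => primePowerTorsion ℓ A (n + 1))
    (fun n => torsionTransition ℓ A (n + 1))))

/-- The component of an element of the Tate module in `A[ℓ ^ (n + 1)]`. -/
def component (n : ℕ) : TateModule ℓ A →+ primePowerTorsion ℓ A (n + 1) where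
  toFun P := P.1 n
  map_zero' := rfl
  map_add' _ _ := rfl

variable {ℓ A}

theorem ext_component {P Q : TateModule ℓ A} (h : ∀ n, component ℓ A n P = component ℓ A n Q) :
    P = Q :=
  Subtype.ext (funext h)

variable [Fact ℓ.Prime]

/-- The action of `a = (a mod ℓ ^ n)ₙ` on the level `A[ℓ ^ n]`. -/
noncomputable def levelSMul (n : ℕ) (a : ℤ_[ℓ]) (P : primePowerTorsion ℓ A n) :
    primePowerTorsion ℓ A n :=
  letI := primePowerTorsionModule ℓ A n
  PadicInt.toZModPow n a • P

theorem levelSMul_of_cast_eq {n : ℕ} {a : ℤ_[ℓ]} {k : ℤ}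
    (h : PadicInt.toZModPow n a = (k : ZMod (ℓ ^ n))) (P : primePowerTorsion ℓ A n) :
    levelSMul n a P = k • P := by
  let _ := primePowerTorsionModule ℓ A n
  change PadicInt.toZModPow n a • P = k • P
  rw [h, Int.cast_smul_eq_zsmul]

theorem torsionTransition_levelSMul (n : ℕ) (a : ℤ_[ℓ]) (P : primePowerTorsion ℓ A (n + 1)) :
    torsionTransition ℓ A n (levelSMul (n + 1) a P) =
      levelSMul n a (torsionTransition ℓ A n P) := by
  obtain ⟨k, hk⟩ := ZMod.intCast_surjective (PadicInt.toZModPow (n + 1) a)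
  have hk' : PadicInt.toZModPow n a = (k : ZMod (ℓ ^ n)) := by
    rw [← PadicInt.cast_toZModPow n (n + 1) (Nat.le_succ n) a, ← hk]
    exact ZMod.cast_intCast (pow_dvd_pow ℓ (Nat.le_succ n)) k
  rw [levelSMul_of_cast_eq hk.symm, levelSMul_of_cast_eq hk', map_zsmul]

/-- Scalar multiplication of `ℤ_ℓ = lim ℤ/ℓ ^ n` on the Tate module: `a • (Pₙ) = (aₙ • Pₙ)`. -/
noncomputable instance instSMul : SMul ℤ_[ℓ] (TateModule ℓ A) where
  smul a P := ⟨fun n => levelSMul (n + 1) a (P.1 n), fun n => by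
    have h := P.2 n
    rw [torsionTransition_levelSMul, h]⟩

theorem component_smul (n : ℕ) (a : ℤ_[ℓ]) (P : TateModule ℓ A) :
    component ℓ A n (a • P) = levelSMul (n + 1) a (component ℓ A n P) :=
  rfl

noncomputable instance instModule : Module ℤ_[ℓ] (TateModule ℓ A) where
  one_smul P := ext_component fun n => by
    let _ := primePowerTorsionModule ℓ A (n + 1)
    simp [component_smul, levelSMul]
  mul_smul a b P := ext_component fun n => by
    let _ := primePowerTorsionModule ℓ A (n + 1)
    simp [component_smul, levelSMul, mul_smul]
  smul_zero a := ext_component fun n => by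
    let _ := primePowerTorsionModule ℓ A (n + 1)
    simp [component_smul, levelSMul]
  smul_add a P Q := ext_component fun n => by
    let _ := primePowerTorsionModule ℓ A (n + 1)
    simp [component_smul, levelSMul, smul_add]
  add_smul a b P := ext_component fun n => by
    let _ := primePowerTorsionModule ℓ A (n + 1)
    simp [component_smul, levelSMul, add_smul]
  zero_smul P := ext_component fun n => by
    let _ := primePowerTorsionModule ℓ A (n + 1)
    simp [component_smul, levelSMul]

end TateModule

/-! Two facts about E(K) suffice: multiplication by `ℓ` is surjective, and E[ℓ] has ℓ² elements. A
basis of E[ℓ] over ℤ/ℓ then lifts to the Tate module. The lifts generate by a Nakayama argument for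
complete modules and are independent because the Tate module has no ℓ-torsion
(`nonempty_linearEquiv_prod`).

Both facts come from writing x(nP) = f(x)/g(x) with f, g coprime, deg f = n² and deg g = n² - 1. The
pair for n + 2 is obtained from those for n and n + 1 (`IsMulXPair.exists_succ`): x(Q + P) and x(Q -
P) are the roots of a quadratic whose coefficients depend only on x(P) and x(Q), and for Q = (n +
1)P one root is x(nP). Surjectivity amounts to solving f = c g. For all but finitely many c this
equation has n² simple roots, which count a fibre of multiplication by n, a coset of E[n]. -/

namespace WeierstrassCurve.Affine.Point

/-! ### The x-coordinates of P + Q and P - Q. -/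

variable {F : Type*} [Field F] [DecidableEq F] {W : WeierstrassCurve.Affine F}

/-- For affine points with distinct `x`-coordinates, the formulas for the sum and the product of
`x(P + Q)` and `x(P - Q)`. -/
theorem addX_add_addX_neg {x₁ x₂ y₁ y₂ : F} (h₁ : W.Equation x₁ y₁) (h₂ : W.Equation x₂ y₂)
    (hx : x₁ ≠ x₂) :
    (W.addX x₁ x₂ (W.slope x₁ x₂ y₁ y₂) + W.addX x₁ x₂ (W.slope x₁ x₂ y₁ (W.negY x₂ y₂))) *
        (x₁ - x₂) ^ 2 =
      2 * (x₁ + x₂) * (x₁ * x₂) + W.b₂ * (x₁ * x₂) + W.b₄ * (x₁ + x₂) + W.b₆ := by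
  have hd : x₁ - x₂ ≠ 0 := sub_ne_zero.mpr hx
  rw [WeierstrassCurve.Affine.equation_iff] at h₁ h₂
  rw [slope_of_X_ne hx, slope_of_X_ne hx]
  simp only [addX, negY, b₂, b₄, b₆]
  field_simp
  linear_combination 2 * h₁ + 2 * h₂

theorem addX_mul_addX_neg {x₁ x₂ y₁ y₂ : F} (h₁ : W.Equation x₁ y₁) (h₂ : W.Equation x₂ y₂)
    (hx : x₁ ≠ x₂) :
    (W.addX x₁ x₂ (W.slope x₁ x₂ y₁ y₂) * W.addX x₁ x₂ (W.slope x₁ x₂ y₁ (W.negY x₂ y₂))) *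
        (x₁ - x₂) ^ 2 =
      (x₁ * x₂) ^ 2 - W.b₄ * (x₁ * x₂) - W.b₆ * (x₁ + x₂) - W.b₈ := by
  have hd : x₁ - x₂ ≠ 0 := sub_ne_zero.mpr hx
  rw [WeierstrassCurve.Affine.equation_iff] at h₁ h₂
  rw [slope_of_X_ne hx, slope_of_X_ne hx]
  simp only [addX, negY, b₄, b₆, b₈]
  field_simp
  grind

theorem addX_self {x y : F} (h : W.Equation x y) (hy : y ≠ W.negY x y) :
    W.addX x x (W.slope x x y y) * (4 * x ^ 3 + W.b₂ * x ^ 2 + 2 * W.b₄ * x + W.b₆) =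
      x ^ 4 - W.b₄ * x ^ 2 - 2 * W.b₆ * x - W.b₈ := by
  have hd : y - W.negY x y ≠ 0 := sub_ne_zero.mpr hy
  have hs : 4 * x ^ 3 + W.b₂ * x ^ 2 + 2 * W.b₄ * x + W.b₆ = (y - W.negY x y) ^ 2 := by
    rw [WeierstrassCurve.Affine.equation_iff] at h
    simp only [negY, b₂, b₄, b₆]
    linear_combination -4 * h
  rw [hs, slope_of_Y_ne rfl hy]
  rw [WeierstrassCurve.Affine.equation_iff] at h
  simp only [addX]
  field_simp
  simp only [negY, b₄, b₆, b₈]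
  grind

-- A common root of the numerator and denominator of the duplication formula would make `addSubMap`
-- vanish at the nonzero vector (x², 2x, 1), which nonsingularity forbids.
omit [DecidableEq F] in
theorem addSub_doubling_ne_zero [W.IsElliptic] {x : F}
    (h : 4 * x ^ 3 + W.b₂ * x ^ 2 + 2 * W.b₄ * x + W.b₆ = 0) :
    x ^ 4 - W.b₄ * x ^ 2 - 2 * W.b₆ * x - W.b₈ ≠ 0 := by
  intro h'
  have hx : (![x ^ 2, 2 * x, 1] : Fin 3 → F) ≠ 0 := fun h0 => by simpa using congrFun h0 2
  refine WeierstrassCurve.addSubMap_ne_zero W hx ?_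
  ext i
  fin_cases i
  · simp [addSubMap]
    linear_combination h'
  · simp [addSubMap]
    linear_combination h
  · simp [addSubMap]
    ring

/-- The map `WeierstrassCurve.addSubMap` computes the `x`-coordinates of `P + Q` and `P - Q`. -/
theorem exists_xRep_add_sub [W.IsElliptic] (P Q : W.Point) : ∃ c : F, c ≠ 0 ∧
    ∀ s t u : F, s = P.xRep 0 * Q.xRep 0 → t = P.xRep 0 * Q.xRep 1 + P.xRep 1 * Q.xRep 0 →
      u = P.xRep 1 * Q.xRep 1 →
    (P + Q).xRep 0 * (P - Q).xRep 0 =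
      c * (s ^ 2 - W.b₄ * s * u - W.b₆ * t * u - W.b₈ * u ^ 2) ∧
    (P + Q).xRep 0 * (P - Q).xRep 1 + (P + Q).xRep 1 * (P - Q).xRep 0 =
      c * (2 * t * s + W.b₂ * s * u + W.b₄ * t * u + W.b₆ * u ^ 2) ∧
    (P + Q).xRep 1 * (P - Q).xRep 1 = c * (t ^ 2 - 4 * s * u) := by
  -- Both P = Q and P = -Q reduce to doubling: one of P ± Q is then O, represented by (1, 0).
  have hself (R : W.Point) : ∃ c : F, c ≠ 0 ∧
    ∀ s t u : F, s = R.xRep 0 * R.xRep 0 → t = R.xRep 0 * R.xRep 1 + R.xRep 1 * R.xRep 0 →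
      u = R.xRep 1 * R.xRep 1 →
    (R + R).xRep 0 = c * (s ^ 2 - W.b₄ * s * u - W.b₆ * t * u - W.b₈ * u ^ 2) ∧
    (R + R).xRep 1 = c * (2 * t * s + W.b₂ * s * u + W.b₄ * t * u + W.b₆ * u ^ 2) ∧
    0 = c * (t ^ 2 - 4 * s * u) := by
    match R with
    | 0 => exact ⟨1, one_ne_zero, by rintro s t u rfl rfl rfl; simp⟩
    | some x y h =>
      by_cases hy : y = W.negY x y
      -- Here 2R = O and the denominator vanishes, so the scale factor is the inverse of the
      -- numerator.
      · have h2 : 4 * x ^ 3 + W.b₂ * x ^ 2 + 2 * W.b₄ * x + W.b₆ = 0 := by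
          have h1 := (WeierstrassCurve.Affine.equation_iff ..).mp h.1
          simp only [negY] at hy
          simp only [b₂, b₄, b₆]
          linear_combination -4 * h1 + (2 * y + W.a₁ * x + W.a₃) * hy
        have h3 := addSub_doubling_ne_zero h2
        refine ⟨_, inv_ne_zero h3, ?_⟩
        rintro s t u rfl rfl rfl
        rw [add_self_of_Y_eq hy]
        simp only [xRep_zero, xRep_some, Matrix.cons_val_zero, Matrix.cons_val_one]
        refine ⟨?_, ?_, by ring⟩
        · rw [eq_inv_mul_iff_mul_eq₀ h3]
          ring
        · rw [eq_inv_mul_iff_mul_eq₀ h3]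
          linear_combination -h2
      · have h2 : 4 * x ^ 3 + W.b₂ * x ^ 2 + 2 * W.b₄ * x + W.b₆ ≠ 0 := by
          have h1 := (WeierstrassCurve.Affine.equation_iff ..).mp h.1
          have h3 : 4 * x ^ 3 + W.b₂ * x ^ 2 + 2 * W.b₄ * x + W.b₆ = (y - W.negY x y) ^ 2 := by
            simp only [negY, b₂, b₄, b₆]
            linear_combination -4 * h1
          rw [h3]
          exact pow_ne_zero 2 (sub_ne_zero.mpr hy)
        refine ⟨_, inv_ne_zero h2, ?_⟩
        rintro s t u rfl rfl rfl
        rw [add_self_of_Y_ne hy]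
        simp only [xRep_some, Matrix.cons_val_zero, Matrix.cons_val_one]
        refine ⟨?_, ?_, by ring⟩
        · rw [eq_inv_mul_iff_mul_eq₀ h2]
          linear_combination addX_self h.1 hy
        · rw [eq_inv_mul_iff_mul_eq₀ h2]
          ring
  by_cases hPQ : P = Q
  · subst hPQ
    obtain ⟨c, hc, h⟩ := hself P
    refine ⟨c, hc, fun s t u hs ht hu => ?_⟩
    simpa using h s t u hs ht hu
  by_cases hPQ' : P = -Q
  · obtain ⟨c, hc, h⟩ := hself P
    refine ⟨c, hc, fun s t u hs ht hu => ?_⟩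
    obtain rfl : Q = -P := by rw [hPQ', neg_neg]
    rw [xRep_neg] at hs ht hu
    simpa using h s t u hs ht hu
  match P, Q with
  | 0, 0 => exact absurd rfl hPQ
  | 0, some x y h => exact ⟨1, one_ne_zero, by
      rintro s t u rfl rfl rfl
      simp only [xRep_zero, xRep_some, zero_add, zero_sub, xRep_neg,
        Matrix.cons_val_zero, Matrix.cons_val_one]
      refine ⟨?_, ?_, ?_⟩ <;> ring⟩
  | some x y h, 0 => exact ⟨1, one_ne_zero, by
      rintro s t u rfl rfl rfl
      simp only [xRep_zero, xRep_some, add_zero, sub_zero,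
        Matrix.cons_val_zero, Matrix.cons_val_one]
      refine ⟨?_, ?_, ?_⟩ <;> ring⟩
  | some x₁ y₁ h₁, some x₂ y₂ h₂ =>
    have hx : x₁ ≠ x₂ := fun hx => (X_eq_iff (h₁ := h₁) (h₂ := h₂)).mp hx |>.elim hPQ hPQ'
    have hd : (x₁ - x₂) ^ 2 ≠ 0 := pow_ne_zero 2 (sub_ne_zero.mpr hx)
    refine ⟨_, inv_ne_zero hd, ?_⟩
    rintro s t u rfl rfl rfl
    rw [sub_eq_add_neg, neg_some, add_of_X_ne hx, add_of_X_ne hx]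
    simp only [xRep_some, Matrix.cons_val_zero, Matrix.cons_val_one]
    refine ⟨?_, ?_, ?_⟩
    · rw [eq_inv_mul_iff_mul_eq₀ hd]
      linear_combination addX_mul_addX_neg h₁.1 h₂.1 hx
    · rw [eq_inv_mul_iff_mul_eq₀ hd]
      linear_combination addX_add_addX_neg h₁.1 h₂.1 hx
    · rw [eq_inv_mul_iff_mul_eq₀ hd]
      ring

end WeierstrassCurve.Affine.Point

/-! ### Multiplication by n on x-coordinates. -/

open Polynomial

/-- If a binary quadratic form with polynomial coefficients vanishes at a coprime pair `(f, g)`,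
then it is the product of the two corresponding linear forms. -/
theorem Polynomial.exists_factor_of_isCoprime {F : Type*} [Field F] {f g a b c : F[X]}
    (hfg : IsCoprime f g) (hf : f ≠ 0) (hg : g ≠ 0)
    (h : a * g ^ 2 - b * f * g + c * f ^ 2 = 0) :
    ∃ f' g' : F[X], a = f * f' ∧ b = f * g' + g * f' ∧ c = g * g' := by
  obtain ⟨f', rfl⟩ : f ∣ a := (hfg.pow_right (n := 2)).dvd_of_dvd_mul_right
    ⟨b * g - c * f, by linear_combination h⟩
  obtain ⟨g', rfl⟩ : g ∣ c := (hfg.symm.pow_right (n := 2)).dvd_of_dvd_mul_right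
    ⟨b * f - f * f' * g, by linear_combination h⟩
  refine ⟨f', g', rfl, ?_, rfl⟩
  refine mul_left_cancel₀ (mul_ne_zero hf hg) ?_
  linear_combination -h

namespace WeierstrassCurve.Affine

variable {F : Type*} [Field F] (W : WeierstrassCurve.Affine F)

/-- Completing the square turns the equation into z² = 4x³ + b₂x² + 2b₄x + b₆ with z = 2y + a₁x +
a₃. -/
theorem exists_nonsingular [IsAlgClosed F] [CharZero F] [W.IsElliptic] (x : F) :
    ∃ y, W.Nonsingular x y := by
  obtain ⟨z, hz⟩ := IsAlgClosed.exists_eq_mul_self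
    (4 * x ^ 3 + W.b₂ * x ^ 2 + 2 * W.b₄ * x + W.b₆)
  refine ⟨(z - W.a₁ * x - W.a₃) / 2, equation_iff_nonsingular.mp ?_⟩
  rw [equation_iff]
  simp only [b₂, b₄, b₆] at hz
  field_simp
  linear_combination -hz

variable [DecidableEq F]

/-- The pair of polynomials `(f, g)` computes the `x`-coordinate of `n • P` as `f(x) / g(x)`. -/
def IsMulXPair (n : ℕ) (f g : F[X]) : Prop :=
  ∀ (x y : F) (h : W.Nonsingular x y), ∃ c : F, c ≠ 0 ∧
    (n • Point.some x y h).xRep 0 = c * f.eval x ∧ (n • Point.some x y h).xRep 1 = c * g.eval x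

variable {W}

/-- Every x lifts to a point, and the projective representative of x(nP) is never (0, 0). -/
theorem IsMulXPair.eval_ne_zero [IsAlgClosed F] [CharZero F] [W.IsElliptic] {n : ℕ} {f g : F[X]}
    (h : W.IsMulXPair n f g) (x : F) : f.eval x ≠ 0 ∨ g.eval x ≠ 0 := by
  obtain ⟨y, hy⟩ := W.exists_nonsingular x
  obtain ⟨c, -, h0, h1⟩ := h x y hy
  by_contra! hfg
  refine Point.xRep_ne_zero (n • Point.some x y hy) (funext fun i => ?_)
  fin_cases i
  · simp [h0, hfg.1]
  · simp [h1, hfg.2]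

theorem IsMulXPair.isCoprime [IsAlgClosed F] [CharZero F] [W.IsElliptic] {n : ℕ} {f g : F[X]}
    (h : W.IsMulXPair n f g) : IsCoprime f g := by
  refine (Polynomial.isCoprime_iff_aeval_ne_zero_of_isAlgClosed F F f g).mpr fun x => ?_
  simpa using h.eval_ne_zero x

theorem isMulXPair_one : W.IsMulXPair 1 X 1 := fun x y h => ⟨1, one_ne_zero, by simp⟩

theorem isMulXPair_two [W.IsElliptic] :
    W.IsMulXPair 2 (X ^ 4 - C W.b₄ * X ^ 2 - C (2 * W.b₆) * X - C W.b₈)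
      (4 * X ^ 3 + C W.b₂ * X ^ 2 + C (2 * W.b₄) * X + C W.b₆) := fun x y h => by
  obtain ⟨c, hc, H⟩ := Point.exists_xRep_add_sub (Point.some x y h) (Point.some x y h)
  obtain ⟨h0, h1, -⟩ := H _ _ _ rfl rfl rfl
  refine ⟨c, hc, ?_, ?_⟩
  · rw [two_nsmul]
    simp at h0 ⊢
    rw [h0]
    ring
  · rw [two_nsmul]
    simp at h1 ⊢
    rw [h1]
    ring

section Step

variable (W) (f g : F[X])

/-- The product of the `x`-coordinates of `Q + P` and `Q - P`, where `x(Q) = f / g` and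
`x(P) = X`, up to a common factor. -/
noncomputable def addSubProd : F[X] :=
  (f * X) ^ 2 - C W.b₄ * (f * X) * g - C W.b₆ * (f + g * X) * g - C W.b₈ * g ^ 2

/-- The sum of the `x`-coordinates of `Q + P` and `Q - P`, where `x(Q) = f / g` and
`x(P) = X`, up to a common factor. -/
noncomputable def addSubSum : F[X] :=
  2 * (f + g * X) * (f * X) + C W.b₂ * (f * X) * g + C W.b₄ * (f + g * X) * g + C W.b₆ * g ^ 2

end Step

/-- The three-term recursion for the polynomials computing the multiplication maps. -/
theorem IsMulXPair.exists_succ [IsAlgClosed F] [CharZero F] [W.IsElliptic] {n : ℕ}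
    {f g f' g' : F[X]} (h : W.IsMulXPair n f g) (h' : W.IsMulXPair (n + 1) f' g') (hf : f ≠ 0)
    (hg : g ≠ 0) :
    ∃ f'' g'' : F[X], W.IsMulXPair (n + 2) f'' g'' ∧ W.addSubProd f' g' = f * f'' ∧
      (f' - g' * X) ^ 2 = g * g'' := by
  -- The sum and difference formulas for (n + 1)P and P, whose difference is nP.
  have key (x y : F) (hxy : W.Nonsingular x y) : ∃ c : F, c ≠ 0 ∧
      ((n + 2) • Point.some x y hxy).xRep 0 * f.eval x = c * (W.addSubProd f' g').eval x ∧
      ((n + 2) • Point.some x y hxy).xRep 0 * g.eval x +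
        ((n + 2) • Point.some x y hxy).xRep 1 * f.eval x = c * (W.addSubSum f' g').eval x ∧
      ((n + 2) • Point.some x y hxy).xRep 1 * g.eval x = c * ((f' - g' * X) ^ 2).eval x := by
    obtain ⟨c, hc, h0, h1⟩ := h x y hxy
    obtain ⟨c', hc', h0', h1'⟩ := h' x y hxy
    obtain ⟨d, hd, H⟩ := Point.exists_xRep_add_sub ((n + 1) • Point.some x y hxy)
      (Point.some x y hxy)
    obtain ⟨H0, H1, H2⟩ := H _ _ _ rfl rfl rfl
    rw [show (n + 1) • Point.some x y hxy + Point.some x y hxy = (n + 2) • Point.some x y hxy by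
        rw [← succ_nsmul],
      show (n + 1) • Point.some x y hxy - Point.some x y hxy = n • Point.some x y hxy by
        rw [succ_nsmul, add_sub_cancel_right], h0', h1'] at H0 H1 H2
    rw [h0] at H0 H1
    rw [h1] at H1 H2
    simp only [Point.xRep_some, Matrix.cons_val_zero, Matrix.cons_val_one] at H0 H1 H2
    refine ⟨c⁻¹ * d * c' ^ 2, by positivity, ?_, ?_, ?_⟩
    · simp [addSubProd]
      field_simp
      linear_combination H0
    · simp [addSubSum]
      field_simp
      linear_combination H1
    · simp
      field_simp
      linear_combination H2
  -- The quadratic with roots x((n + 2)P) and x(nP) vanishes at x(nP) = f / g. An identity at every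
  -- x is an identity of polynomials.
  have hzero : W.addSubProd f' g' * g ^ 2 - W.addSubSum f' g' * f * g + (f' - g' * X) ^ 2 * f ^ 2
      = 0 := by
    refine Polynomial.funext fun x => ?_
    obtain ⟨y, hxy⟩ := W.exists_nonsingular x
    obtain ⟨c, hc, h0, h1, h2⟩ := key x y hxy
    refine mul_left_cancel₀ hc ?_
    simp only [eval_sub, eval_add, eval_mul, eval_pow, eval_zero] at h0 h1 h2 ⊢
    linear_combination -g.eval x ^ 2 * h0 + f.eval x * g.eval x * h1 - f.eval x ^ 2 * h2
  obtain ⟨f'', g'', e0, e1, e2⟩ := Polynomial.exists_factor_of_isCoprime h.isCoprime hf hg hzero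
  refine ⟨f'', g'', fun x y hxy => ?_, e0, e2⟩
  obtain ⟨c, hc, h0, h1, h2⟩ := key x y hxy
  refine ⟨c, hc, ?_⟩
  rw [e0] at h0
  rw [e1] at h1
  rw [e2] at h2
  simp only [eval_add, eval_mul] at h0 h1 h2
  -- Cancelling whichever of f(x), g(x) is nonzero gives one coordinate; the middle relation then
  -- gives the other.
  rcases h.eval_ne_zero x with hx | hx
  · have h3 : ((n + 2) • Point.some x y hxy).xRep 0 = c * f''.eval x :=
      mul_right_cancel₀ hx (by linear_combination h0)
    refine ⟨h3, mul_right_cancel₀ hx ?_⟩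
    rw [h3] at h1
    linear_combination h1
  · have h3 : ((n + 2) • Point.some x y hxy).xRep 1 = c * g''.eval x :=
      mul_right_cancel₀ hx (by linear_combination h2)
    refine ⟨mul_right_cancel₀ hx ?_, h3⟩
    rw [h3] at h1
    linear_combination h1

end WeierstrassCurve.Affine

/-! ### Degrees and leading coefficients. -/

namespace WeierstrassCurve.Affine

variable {F : Type*} [Field F] {W : WeierstrassCurve.Affine F}

theorem natDegree_addSubProd_sub_le {f g : F[X]} {m : ℕ} (hf : f.natDegree ≤ m)
    (hg : g.natDegree + 1 ≤ m) :
    (C W.b₄ * (f * X) * g + C W.b₆ * (f + g * X) * g + C W.b₈ * g ^ 2).natDegree ≤ 2 * m := by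
  have hC (a : F) : (C a).natDegree ≤ 0 := (natDegree_C a).le
  have hfX : (f * X).natDegree ≤ m + 1 := natDegree_mul_le_of_le hf natDegree_X_le
  have hgX : (g * X).natDegree ≤ m := (natDegree_mul_le_of_le le_rfl natDegree_X_le).trans hg
  refine natDegree_add_le_of_degree_le (natDegree_add_le_of_degree_le ?_ ?_) ?_
  · exact (natDegree_mul_le_of_le (natDegree_mul_le_of_le (hC _) hfX) le_rfl).trans (by lia)
  · exact (natDegree_mul_le_of_le (natDegree_mul_le_of_le (hC _)
      (natDegree_add_le_of_degree_le hf hgX)) le_rfl).trans (by lia)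
  · exact (natDegree_mul_le_of_le (hC _) (natDegree_pow_le_of_le 2 le_rfl)).trans (by lia)

theorem addSubProd_monic_and_natDegree {f g : F[X]} {m : ℕ} (hf : f.Monic) (hfm : f.natDegree = m)
    (hg : g.natDegree + 1 ≤ m) :
    (W.addSubProd f g).Monic ∧ (W.addSubProd f g).natDegree = 2 * m + 2 := by
  have h1 : ((f * X) ^ 2).Monic := (hf.mul monic_X).pow 2
  have h2 : ((f * X) ^ 2).natDegree = 2 * m + 2 := by
    rw [(hf.mul monic_X).natDegree_pow, hf.natDegree_mul monic_X, hfm, natDegree_X]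
    ring
  have h3 := natDegree_addSubProd_sub_le (W := W) hfm.le hg
  have h4 : W.addSubProd f g = (f * X) ^ 2 -
      (C W.b₄ * (f * X) * g + C W.b₆ * (f + g * X) * g + C W.b₈ * g ^ 2) := by
    rw [addSubProd]
    ring
  rw [h4]
  refine ⟨h1.sub_of_left (degree_lt_degree (by lia)), ?_⟩
  rw [natDegree_sub_eq_left_of_natDegree_lt (by lia), h2]

theorem natDegree_and_leadingCoeff_sub_mul_X {f g : F[X]} {m : ℕ} (hf : f.Monic)
    (hfm : f.natDegree = m) (hg : g.natDegree + 1 = m) (h1 : g.leadingCoeff ≠ 1) :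
    (f - g * X).natDegree = m ∧ (f - g * X).leadingCoeff = 1 - g.leadingCoeff := by
  have hc : (f - g * X).coeff m = 1 - g.leadingCoeff := by
    rw [coeff_sub, ← hg, coeff_mul_X, hg, ← hfm, hf.coeff_natDegree, leadingCoeff]
  have hd : (f - g * X).natDegree = m := by
    refine natDegree_eq_of_le_of_coeff_ne_zero ?_ (by rw [hc]; exact sub_ne_zero.mpr h1.symm)
    exact (natDegree_sub_le_of_le hfm.le
      ((natDegree_mul_le_of_le le_rfl natDegree_X_le).trans hg.le)).trans (max_self m).le
  exact ⟨hd, by rw [leadingCoeff, hd, hc]⟩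

variable [DecidableEq F]

/-- Multiplication by `n ≥ 1` is given on `x`-coordinates by a fraction `f / g` with `f` monic of
degree `n ^ 2` and `g` of degree `n ^ 2 - 1` with leading coefficient `n ^ 2`. -/
theorem exists_isMulXPair [IsAlgClosed F] [CharZero F] [W.IsElliptic] (n : ℕ) :
    ∃ f g : F[X], W.IsMulXPair (n + 1) f g ∧ f.Monic ∧ f.natDegree = (n + 1) ^ 2 ∧
      g.natDegree + 1 = (n + 1) ^ 2 ∧ g.leadingCoeff = (n + 1) ^ 2 := by
  induction n using Nat.twoStepInduction with
  | zero => exact ⟨X, 1, isMulXPair_one, monic_X, by simp, by simp, by simp⟩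
  | one =>
    have hd : (4 * X ^ 3 + C W.b₂ * X ^ 2 + C (2 * W.b₄) * X + C W.b₆ : F[X]).natDegree = 3 := by
      compute_degree!
    refine ⟨_, _, isMulXPair_two, ?_, ?_, ?_, ?_⟩
    · monicity!
    · compute_degree!
    · rw [hd]
      norm_num
    · rw [leadingCoeff, hd]
      simp [coeff_ofNat_mul]
      norm_num
  | more n ih ih' =>
    obtain ⟨f, g, h, hf, hfd, hgd, hgl⟩ := ih
    obtain ⟨f', g', h', hf', hfd', hgd', hgl'⟩ := ih'
    have hn1 : ((n : F) + 1) ^ 2 ≠ 0 := by exact_mod_cast (by positivity : ((n + 1) ^ 2 : ℕ) ≠ 0)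
    have hg : g ≠ 0 := leadingCoeff_ne_zero.mp (hgl ▸ hn1)
    obtain ⟨f'', g'', h'', hprod, hsq⟩ := h.exists_succ h' hf.ne_zero hg
    -- The multiplier n + 2 is at least 2, so the top terms of f' and g'X do not cancel.
    have hgl1 : g'.leadingCoeff ≠ 1 := by
      rw [hgl']
      push_cast
      intro h0
      have h1 : ((n + 1 + 1) ^ 2 : ℕ) = 1 := by exact_mod_cast h0
      rw [Nat.pow_eq_one] at h1
      lia
    obtain ⟨hd, hl⟩ := natDegree_and_leadingCoeff_sub_mul_X hf' hfd' hgd' hgl1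
    obtain ⟨hm, hmd⟩ := addSubProd_monic_and_natDegree (W := W) hf' hfd' hgd'.le
    rw [hprod] at hm hmd
    have hf'' : f''.Monic := hf.of_mul_monic_left hm
    have hg'' : g'' ≠ 0 := by
      rintro rfl
      rw [mul_zero, sq_eq_zero_iff] at hsq
      rw [hsq, natDegree_zero] at hd
      have : 0 < (n + 1 + 1) ^ 2 := by positivity
      lia
    refine ⟨f'', g'', h'', hf'', ?_, ?_, ?_⟩
    -- 2(n + 2)² + 2 = (n + 1)² + (n + 3)².
    · rw [hf.natDegree_mul hf'', hfd] at hmd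
      nlinarith
    · have := congrArg natDegree hsq
      rw [natDegree_pow, hd, natDegree_mul hg hg''] at this
      nlinarith
    -- (1 - (n + 2)²)² = (n + 1)²(n + 3)².
    · have := congrArg leadingCoeff hsq
      rw [leadingCoeff_pow, hl, leadingCoeff_mul, hgl, hgl'] at this
      refine mul_left_cancel₀ hn1 ?_
      rw [← this]
      push_cast
      ring

end WeierstrassCurve.Affine

/-! ### Separability, divisibility and the order of E[n]. -/

/-- For a coprime pair of polynomials with `deg g < deg f` in characteristic zero, all but finitely
many members of the pencil `f - c g` are separable. -/
theorem Polynomial.finite_setOf_not_separable {F : Type*} [Field F] [IsAlgClosed F] [CharZero F]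
    {f g : F[X]} (hfg : IsCoprime f g) (hd : g.natDegree < f.natDegree) :
    {c : F | ¬ (f - C c * g).Separable}.Finite := by
  -- The Wronskian: a multiple root x of f - c g is a zero of w and determines c = f(x)/g(x). If w
  -- were 0, then f would divide its derivative.
  set w : F[X] := derivative f * g - f * derivative g with hw
  have hw0 : w ≠ 0 := by
    intro h0
    have hdvd : f ∣ derivative f :=
      hfg.dvd_of_dvd_mul_right ⟨derivative g, by linear_combination hw.symm.trans h0⟩
    have hf0 : derivative f ≠ 0 := fun h => by
      have := derivative_eq_zero.mp h
      lia
    have h1 := natDegree_le_of_dvd hdvd hf0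
    have h2 := natDegree_derivative_lt (p := f) (by lia)
    lia
  have hfin := (w.rootSet_finite F).image fun x => f.eval x / g.eval x
  refine hfin.subset fun c hc => ?_
  rw [Set.mem_ofPred_eq, Separable,
    Polynomial.isCoprime_iff_aeval_ne_zero_of_isAlgClosed F F] at hc
  push Not at hc
  obtain ⟨x, h0, h1⟩ := hc
  simp only [coe_aeval_eq_eval, derivative_sub, derivative_mul, derivative_C, zero_mul, zero_add,
    eval_sub, eval_mul, eval_C] at h0 h1
  have hg : g.eval x ≠ 0 := by
    intro hg
    have hf : f.eval x = 0 := by simpa [hg] using h0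
    have := (Polynomial.isCoprime_iff_aeval_ne_zero_of_isAlgClosed F F f g).mp hfg x
    simp [hf, hg] at this
  refine ⟨x, ?_, ?_⟩
  · rw [mem_rootSet]
    refine ⟨hw0, ?_⟩
    simp only [hw, coe_aeval_eq_eval, eval_sub, eval_mul]
    linear_combination g.eval x * h1 - (derivative g).eval x * h0
  · simp only
    rw [div_eq_iff hg]
    linear_combination h0

namespace WeierstrassCurve.Affine

variable {F : Type*} [Field F] [DecidableEq F] {W : WeierstrassCurve.Affine F}

theorem IsMulXPair.nsmul_eq_or_eq_neg {n : ℕ} {f g : F[X]} (h : W.IsMulXPair n f g) {x y x' y' : F}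
    (hxy : W.Nonsingular x y) (hxy' : W.Nonsingular x' y') (hx : (f - C x' * g).eval x = 0) :
    n • Point.some x y hxy = Point.some x' y' hxy' ∨
      n • Point.some x y hxy = -Point.some x' y' hxy' := by
  obtain ⟨c, hc, h0, h1⟩ := h x y hxy
  have hx' : f.eval x = x' * g.eval x := by
    simp only [eval_sub, eval_mul, eval_C] at hx
    linear_combination hx
  rw [hx'] at h0
  rcases hP : n • Point.some x y hxy with _ | ⟨u, v, huv⟩
  · rw [hP] at h0 h1
    simp only [← Point.zero_def, Point.xRep_zero, Matrix.cons_val_zero, Matrix.cons_val_one] at h0 h1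
    exact absurd (by linear_combination h0 - x' * h1) (one_ne_zero (α := F))
  · rw [hP] at h0 h1
    simp only [Point.xRep_some, Matrix.cons_val_zero, Matrix.cons_val_one] at h0 h1
    exact Point.X_eq_iff.mp (by linear_combination h0 - x' * h1)

theorem IsMulXPair.eval_eq_zero {n : ℕ} {f g : F[X]} (h : W.IsMulXPair n f g) {x y x' y' : F}
    (hxy : W.Nonsingular x y) (hxy' : W.Nonsingular x' y')
    (hP : n • Point.some x y hxy = Point.some x' y' hxy') : (f - C x' * g).eval x = 0 := by
  obtain ⟨c, hc, h0, h1⟩ := h x y hxy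
  rw [hP] at h0 h1
  simp only [Point.xRep_some, Matrix.cons_val_zero, Matrix.cons_val_one] at h0 h1
  refine mul_left_cancel₀ hc ?_
  simp only [eval_sub, eval_mul, eval_C]
  linear_combination -h0 + x' * h1

variable [IsAlgClosed F] [CharZero F] [W.IsElliptic]

/-- The group of points over an algebraically closed field of characteristic zero is divisible. -/
theorem Point.nsmul_surjective {n : ℕ} (hn : n ≠ 0) :
    Function.Surjective fun P : W.Point => n • P := by
  obtain ⟨m, rfl⟩ := Nat.exists_eq_succ_of_ne_zero hn
  obtain ⟨f, g, h, -, hfd, hgd, -⟩ := W.exists_isMulXPair m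
  intro Q
  rcases Q with _ | ⟨x', y', hxy'⟩
  · exact ⟨0, smul_zero _⟩
  have hd : (f - C x' * g).natDegree = (m + 1) ^ 2 := by
    rw [natDegree_sub_eq_left_of_natDegree_lt, hfd]
    exact (natDegree_C_mul_le _ _).trans_lt (by lia)
  obtain ⟨x, hx⟩ := IsAlgClosed.exists_root (f - C x' * g) fun h0 => by
    rw [natDegree_eq_of_degree_eq_some h0] at hd
    exact absurd hd.symm (by positivity)
  obtain ⟨y, hxy⟩ := W.exists_nonsingular x
  -- The root fixes nP only up to sign; replacing P by -P corrects it.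
  rcases h.nsmul_eq_or_eq_neg hxy hxy' hx with hP | hP
  · exact ⟨_, hP⟩
  · exact ⟨-Point.some x y hxy, by
      change (m + 1) • (-Point.some x y hxy) = _
      rw [smul_neg, hP, neg_neg]⟩

/-- The fibre of multiplication by `n` over a point that is not its own negative is in bijection
with the roots of a polynomial. -/
theorem IsMulXPair.card_fiber {n : ℕ} {f g : F[X]} (h : W.IsMulXPair n f g) {x' y' : F}
    (hxy' : W.Nonsingular x' y') (hy' : y' ≠ W.negY x' y') (hs : (f - C x' * g).Separable) :
    Nat.card {P : W.Point // n • P = Point.some x' y' hxy'} = (f - C x' * g).natDegree := by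
  have hQ : Point.some x' y' hxy' ≠ -Point.some x' y' hxy' := fun h0 => hy' (by
    rw [Point.neg_some, Point.some.injEq] at h0
    exact h0.2)
  have hs0 : f - C x' * g ≠ 0 := hs.ne_zero
  let φ : {P : W.Point // n • P = Point.some x' y' hxy'} → (f - C x' * g).rootSet F :=
    fun P => ⟨P.1.xRep 0, by
      obtain ⟨_ | ⟨x, y, hxy⟩, hP⟩ := P
      · rw [← Point.zero_def, smul_zero] at hP
        exact absurd hP.symm (Point.some_ne_zero hxy')
      · rw [mem_rootSet, coe_aeval_eq_eval]
        exact ⟨hs0, h.eval_eq_zero hxy hxy' hP⟩⟩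
  have hφ : Function.Bijective φ := by
    constructor
    -- Points with equal x differ by a sign, and P, -P cannot both lie over a target that is not its
    -- own negative.
    · rintro ⟨P, hP⟩ ⟨P', hP'⟩ hPP'
      have hx : P.xRep 0 = P'.xRep 0 := congrArg Subtype.val hPP'
      have hor : P = P' ∨ P = -P' := by
        rcases P with _ | ⟨x, y, hxy⟩
        · rw [← Point.zero_def, smul_zero] at hP
          exact absurd hP.symm (Point.some_ne_zero hxy')
        rcases P' with _ | ⟨u, v, huv⟩
        · rw [← Point.zero_def, smul_zero] at hP'
          exact absurd hP'.symm (Point.some_ne_zero hxy')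
        exact Point.X_eq_iff.mp hx
      rcases hor with rfl | rfl
      · rfl
      · rw [smul_neg, hP'] at hP
        exact absurd hP.symm hQ
    · rintro ⟨x, hx⟩
      rw [mem_rootSet, coe_aeval_eq_eval] at hx
      obtain ⟨y, hxy⟩ := W.exists_nonsingular x
      rcases h.nsmul_eq_or_eq_neg hxy hxy' hx.2 with hP | hP
      · exact ⟨⟨_, hP⟩, rfl⟩
      · refine ⟨⟨-Point.some x y hxy, by rw [smul_neg, hP, neg_neg]⟩, Subtype.ext ?_⟩
        simp only [φ, Point.xRep_neg, Point.xRep_some, Matrix.cons_val_zero]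
  rw [Nat.card_congr (Equiv.ofBijective φ hφ), Nat.card_eq_fintype_card]
  exact card_rootSet_eq_natDegree hs (IsAlgClosed.splits_domain _)

/-- Over an algebraically closed field of characteristic zero, `E[n]` has `n ^ 2` elements. -/
theorem Point.card_nsmul_eq_zero {n : ℕ} (hn : n ≠ 0) :
    Nat.card {P : W.Point // n • P = 0} = n ^ 2 := by
  obtain ⟨m, rfl⟩ := Nat.exists_eq_succ_of_ne_zero hn
  obtain ⟨f, g, h, -, hfd, hgd, -⟩ := W.exists_isMulXPair m
  set q : F[X] := C 4 * X ^ 3 + C W.b₂ * X ^ 2 + C (2 * W.b₄) * X + C W.b₆ with hq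
  have hq0 : q ≠ 0 := by
    intro h0
    have h3 : q.coeff 3 = 4 := by simp [hq]
    rw [h0, coeff_zero] at h3
    exact (OfNat.ofNat_ne_zero 4 : (4 : F) ≠ 0) h3.symm
  -- Avoid the c with a non-separable fibre polynomial and the c that are x-coordinates of 2-torsion
  -- points.
  have hfin := (finite_setOf_not_separable h.isCoprime (by lia)).union (q.rootSet_finite F)
  obtain ⟨c, hc⟩ := hfin.exists_notMem
  simp only [Set.mem_union, Set.mem_ofPred_eq, not_or, not_not] at hc
  obtain ⟨hs, hc⟩ := hc
  obtain ⟨d, hcd⟩ := W.exists_nonsingular c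
  have hd : d ≠ W.negY c d := by
    intro hd
    refine hc ?_
    rw [mem_rootSet, coe_aeval_eq_eval]
    refine ⟨hq0, ?_⟩
    have h1 := (equation_iff ..).mp hcd.1
    simp only [negY] at hd
    simp only [hq, eval_add, eval_mul, eval_C, eval_pow, eval_X, b₂, b₄, b₆]
    linear_combination -4 * h1 + (2 * d + W.a₁ * c + W.a₃) * hd
  obtain ⟨P₀, hP₀⟩ := nsmul_surjective (W := W) hn (Point.some c d hcd)
  have hcard := h.card_fiber hcd hd hs
  rw [natDegree_sub_eq_left_of_natDegree_lt
    ((natDegree_C_mul_le _ _).trans_lt (by lia)), hfd] at hcard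
  rw [← hcard]
  -- Translation by P₀ carries E[n] to the fibre.
  refine Nat.card_congr ((Equiv.addRight P₀).subtypeEquiv fun P => ?_)
  change _ ↔ (m + 1) • (P + P₀) = _
  simp only at hP₀
  rw [smul_add, hP₀, add_eq_right]

end WeierstrassCurve.Affine

/-! ### Adic completeness of products. -/

theorem SModEq.map_pow_smul_top {R M N : Type*} [CommRing R] [AddCommGroup M] [Module R M]
    [AddCommGroup N] [Module R N] (I : Ideal R) (φ : M →ₗ[R] N) {n : ℕ} {x y : M}
    (h : x ≡ y [SMOD (I ^ n • ⊤ : Submodule R M)]) :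
    φ x ≡ φ y [SMOD (I ^ n • ⊤ : Submodule R N)] := by
  refine (SModEq.map h φ).mono ?_
  rw [Submodule.map_smul'']
  exact Submodule.smul_mono le_rfl le_top

/-- Makes ℤ_ℓ × ℤ_ℓ an admissible source for the surjectivity criterion modulo the maximal ideal. -/
instance IsPrecomplete.prod {R M N : Type*} [CommRing R] [AddCommGroup M] [Module R M]
    [AddCommGroup N] [Module R N] (I : Ideal R) [IsPrecomplete I M] [IsPrecomplete I N] :
    IsPrecomplete I (M × N) := by
  constructor
  intro f hf
  obtain ⟨a, ha⟩ := IsPrecomplete.prec ‹IsPrecomplete I M› (f := fun n => (f n).1)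
    fun {m n} hmn => SModEq.map_pow_smul_top I (LinearMap.fst R M N) (hf hmn)
  obtain ⟨b, hb⟩ := IsPrecomplete.prec ‹IsPrecomplete I N› (f := fun n => (f n).2)
    fun {m n} hmn => SModEq.map_pow_smul_top I (LinearMap.snd R M N) (hf hmn)
  refine ⟨(a, b), fun n => ?_⟩
  have h := (SModEq.map_pow_smul_top I (LinearMap.inl R M N) (ha n)).add (SModEq.map_pow_smul_top I (LinearMap.inr R M N) (hb n))
  simpa using h

/-! ### Freeness of the Tate module. -/

namespace TateModule

variable {ℓ : ℕ} {A : Type*} [AddCommGroup A]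

/-- The element of the Tate module given by a compatible sequence. -/
def ofSeq (g : ∀ n, primePowerTorsion ℓ A (n + 1)) (h : ∀ n, ℓ • (g (n + 1) : A) = g n) :
    TateModule ℓ A :=
  ⟨g, fun n => Subtype.ext (h n)⟩

theorem component_ofSeq (g : ∀ n, primePowerTorsion ℓ A (n + 1))
    (h : ∀ n, ℓ • (g (n + 1) : A) = g n) (n : ℕ) : component ℓ A n (ofSeq g h) = g n :=
  rfl

theorem nsmul_component_succ (P : TateModule ℓ A) (n : ℕ) :
    ℓ • (component ℓ A (n + 1) P : A) = component ℓ A n P :=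
  congrArg Subtype.val (P.2 n)

theorem pow_nsmul_component (P : TateModule ℓ A) (n : ℕ) :
    ℓ ^ (n + 1) • (component ℓ A n P : A) = 0 :=
  AddSubgroup.torsionBy.nsmul_iff.mp (component ℓ A n P).2

theorem eq_zero_of_nsmul_eq_zero {P : TateModule ℓ A} (h : ℓ • P = 0) : P = 0 := by
  refine ext_component fun n => Subtype.ext ?_
  rw [← nsmul_component_succ, map_zero]
  have := congrArg (fun Q => (component ℓ A (n + 1) Q : A)) h
  simpa [map_nsmul] using this

/-- Division by ℓ is the shift Qₙ = Pₙ₊₁; the vanishing first component puts each shifted entry in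
the right torsion level. -/
theorem exists_nsmul_eq_of_component_zero {P : TateModule ℓ A} (h : component ℓ A 0 P = 0) :
    ∃ Q : TateModule ℓ A, ℓ • Q = P := by
  have key (n : ℕ) : ℓ ^ n • (component ℓ A n P : A) = 0 := by
    induction n with
    | zero => simp [h]
    | succ n ih => rw [pow_succ, mul_smul, nsmul_component_succ, ih]
  let g (n : ℕ) : primePowerTorsion ℓ A (n + 1) :=
    ⟨component ℓ A (n + 1) P, AddSubgroup.torsionBy.nsmul_iff.mpr (key (n + 1))⟩
  have hg (n : ℕ) : (g n : A) = component ℓ A (n + 1) P := rfl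
  refine ⟨ofSeq g fun n => ?_, ext_component fun n => Subtype.ext ?_⟩
  · rw [hg, hg, nsmul_component_succ]
  · rw [map_nsmul, AddSubgroup.coe_nsmul, component_ofSeq, hg, nsmul_component_succ]

/-- Iterating a chosen section of multiplication by ℓ builds the compatible sequence. -/
theorem component_zero_surjective (h : Function.Surjective fun a : A => ℓ • a) :
    Function.Surjective (component ℓ A 0) := by
  intro a
  choose g hg using h
  simp only at hg
  have key (n : ℕ) : ℓ ^ (n + 1) • g^[n] (a : A) = 0 := by
    induction n with
    | zero => exact AddSubgroup.torsionBy.nsmul_iff.mp a.2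
    | succ n ih => rw [pow_succ, mul_smul, Function.iterate_succ_apply', hg, ih]
  refine ⟨ofSeq (fun n => ⟨g^[n] (a : A), AddSubgroup.torsionBy.nsmul_iff.mpr (key n)⟩)
    fun n => ?_, rfl⟩
  simp only [Function.iterate_succ_apply', hg]

variable [Fact ℓ.Prime]

open IsLocalRing

theorem mem_maximalIdeal_pow_smul_top {n : ℕ} {P : TateModule ℓ A} :
    P ∈ (maximalIdeal ℤ_[ℓ] ^ n • ⊤ : Submodule ℤ_[ℓ] (TateModule ℓ A)) ↔
      ∃ Q : TateModule ℓ A, ℓ ^ n • Q = P := by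
  rw [PadicInt.maximalIdeal_eq_span_p, Ideal.span_singleton_pow,
    Submodule.ideal_span_singleton_smul, Submodule.mem_smul_pointwise_iff_exists]
  simp only [Submodule.mem_top, true_and, ← Nat.cast_pow, Nat.cast_smul_eq_nsmul]

/-- The component of index n is killed by ℓ ^ (n + 1), hence it vanishes on multiples of ℓ ^ (n +
1). -/
instance : IsHausdorff (maximalIdeal ℤ_[ℓ]) (TateModule ℓ A) where
  haus' P hP := ext_component fun n => Subtype.ext <| by
    obtain ⟨Q, rfl⟩ := mem_maximalIdeal_pow_smul_top.mp (SModEq.zero.mp (hP (n + 1)))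
    rw [map_nsmul, AddSubgroup.coe_nsmul, pow_nsmul_component, map_zero]
    rfl

theorem component_zero_smul (a : ℤ_[ℓ]) : ∃ k : ℤ, (∀ P : TateModule ℓ A,
    component ℓ A 0 (a • P) = k • component ℓ A 0 P) ∧ ((ℓ : ℤ) ∣ k → (ℓ : ℤ_[ℓ]) ∣ a) := by
  obtain ⟨k, hk⟩ := ZMod.intCast_surjective (PadicInt.toZModPow 1 a)
  refine ⟨k, fun P => levelSMul_of_cast_eq hk.symm _, fun h => ?_⟩
  have h0 : PadicInt.toZModPow 1 a = 0 := by
    rw [← hk, ZMod.intCast_zmod_eq_zero_iff_dvd]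
    simpa using h
  rwa [← RingHom.mem_ker, PadicInt.ker_toZModPow, Ideal.mem_span_singleton, pow_one] at h0

variable (e₁ e₂ : TateModule ℓ A)

/-- Nakayama for a precomplete source and a Hausdorff target: surjectivity modulo ℓ suffices, and
the first component detects divisibility by ℓ. -/
theorem coprod_toSpanSingleton_surjective
    (h : ∀ a : primePowerTorsion ℓ A 1, ∃ k m : ℤ,
      k • component ℓ A 0 e₁ + m • component ℓ A 0 e₂ = a) :
    Function.Surjective ((LinearMap.toSpanSingleton ℤ_[ℓ] _ e₁).coprod
      (LinearMap.toSpanSingleton ℤ_[ℓ] _ e₂)) := by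
  refine surjective_of_mkQ_comp_surjective (I := maximalIdeal ℤ_[ℓ]) fun y => ?_
  obtain ⟨P, rfl⟩ := Submodule.mkQ_surjective _ y
  obtain ⟨k, m, hkm⟩ := h (component ℓ A 0 P)
  refine ⟨((k : ℤ_[ℓ]), (m : ℤ_[ℓ])), ?_⟩
  rw [LinearMap.comp_apply, ← sub_eq_zero, ← map_sub, Submodule.mkQ_apply,
    Submodule.Quotient.mk_eq_zero, ← pow_one (maximalIdeal ℤ_[ℓ]), mem_maximalIdeal_pow_smul_top,
    pow_one]
  refine exists_nsmul_eq_of_component_zero ?_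
  simp only [LinearMap.coprod_apply, LinearMap.toSpanSingleton_apply, Int.cast_smul_eq_zsmul]
  rw [map_sub, map_add, map_zsmul, map_zsmul, hkm, sub_self]

/-- Descent: independence in A[ℓ] makes a kernel vector divisible by ℓ, and torsion-freeness keeps
the quotient in the kernel. Its coordinates are divisible by every power of ℓ, hence zero. -/
theorem coprod_toSpanSingleton_injective
    (h : ∀ k m : ℤ, k • component ℓ A 0 e₁ + m • component ℓ A 0 e₂ = 0 →
      (ℓ : ℤ) ∣ k ∧ (ℓ : ℤ) ∣ m) :
    Function.Injective ((LinearMap.toSpanSingleton ℤ_[ℓ] _ e₁).coprod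
      (LinearMap.toSpanSingleton ℤ_[ℓ] _ e₂)) := by
  set φ := (LinearMap.toSpanSingleton ℤ_[ℓ] _ e₁).coprod (LinearMap.toSpanSingleton ℤ_[ℓ] _ e₂)
  have step (v : ℤ_[ℓ] × ℤ_[ℓ]) (hv : φ v = 0) : ∃ w, φ w = 0 ∧ (ℓ : ℤ_[ℓ]) • w = v := by
    obtain ⟨a, b⟩ := v
    obtain ⟨k, hk, hk'⟩ := component_zero_smul (A := A) a
    obtain ⟨m, hm, hm'⟩ := component_zero_smul (A := A) b
    have h0 := congrArg (component ℓ A 0) hv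
    simp only [φ, LinearMap.coprod_apply, LinearMap.toSpanSingleton_apply, map_add, map_zero,
      hk, hm] at h0
    obtain ⟨a, rfl⟩ := hk' (h k m h0).1
    obtain ⟨b, rfl⟩ := hm' (h k m h0).2
    refine ⟨(a, b), eq_zero_of_nsmul_eq_zero (ℓ := ℓ) ?_, rfl⟩
    rw [← Nat.cast_smul_eq_nsmul ℤ_[ℓ], ← map_smul, ← hv]
    rfl
  have hpow (n : ℕ) (v : ℤ_[ℓ] × ℤ_[ℓ]) (hv : φ v = 0) : ∃ w, (ℓ : ℤ_[ℓ]) ^ n • w = v := by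
    induction n generalizing v with
    | zero => exact ⟨v, by simp⟩
    | succ n ih =>
      obtain ⟨w, hw, rfl⟩ := step v hv
      obtain ⟨u, rfl⟩ := ih w hw
      exact ⟨u, by rw [pow_succ', mul_smul]⟩
  have hzero (a : ℤ_[ℓ]) (ha : ∀ n : ℕ, (ℓ : ℤ_[ℓ]) ^ n ∣ a) : a = 0 := by
    refine IsHausdorff.haus (I := maximalIdeal ℤ_[ℓ]) inferInstance a fun n => ?_
    rw [SModEq.zero, PadicInt.maximalIdeal_eq_span_p, Ideal.span_singleton_pow, smul_eq_mul,
      Ideal.mul_top, Ideal.mem_span_singleton]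
    exact ha n
  refine (injective_iff_map_eq_zero φ).mpr fun v hv => Prod.ext (hzero _ fun n => ?_)
    (hzero _ fun n => ?_)
  · obtain ⟨w, rfl⟩ := hpow n v hv
    exact ⟨w.1, rfl⟩
  · obtain ⟨w, rfl⟩ := hpow n v hv
    exact ⟨w.2, rfl⟩

theorem exists_basis_of_card {V : Type*} [AddCommGroup V] [Module (ZMod ℓ) V]
    (h : Nat.card V = ℓ ^ 2) :
    ∃ a b : V, (∀ c, ∃ k m : ℤ, k • a + m • b = c) ∧
      ∀ k m : ℤ, k • a + m • b = 0 → (ℓ : ℤ) ∣ k ∧ (ℓ : ℤ) ∣ m := by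
  have hℓ : ℓ.Prime := Fact.out
  have : Finite V := Nat.finite_of_card_ne_zero (by rw [h]; exact pow_ne_zero 2 hℓ.ne_zero)
  have hrank : Module.finrank (ZMod ℓ) V = 2 := by
    have h1 := Module.natCard_eq_pow_finrank (K := ZMod ℓ) (V := V)
    rw [h, Nat.card_zmod] at h1
    exact (Nat.pow_right_injective hℓ.two_le h1).symm
  let B : Module.Basis (Fin 2) (ZMod ℓ) V := Module.finBasisOfFinrankEq _ _ hrank
  refine ⟨B 0, B 1, fun c => ?_, fun k m hkm => ?_⟩
  · obtain ⟨k, hk⟩ := ZMod.intCast_surjective (B.repr c 0)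
    obtain ⟨m, hm⟩ := ZMod.intCast_surjective (B.repr c 1)
    refine ⟨k, m, ?_⟩
    rw [← Int.cast_smul_eq_zsmul (ZMod ℓ), ← Int.cast_smul_eq_zsmul (ZMod ℓ), hk, hm,
      ← Fin.sum_univ_two (fun i => B.repr c i • B i), B.sum_repr]
  · rw [← Int.cast_smul_eq_zsmul (ZMod ℓ), ← Int.cast_smul_eq_zsmul (ZMod ℓ)] at hkm
    have h1 := Fintype.linearIndependent_iff.mp B.linearIndependent ![(k : ZMod ℓ), (m : ZMod ℓ)]
      (by simpa [Fin.sum_univ_two] using hkm)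
    exact ⟨(ZMod.intCast_zmod_eq_zero_iff_dvd _ _).mp (h1 0),
      (ZMod.intCast_zmod_eq_zero_iff_dvd _ _).mp (h1 1)⟩

/-- If `A` is `ℓ`-divisible and `A[ℓ]` has `ℓ ^ 2` elements, then the Tate module of `A` is free of
rank `2`. -/
theorem nonempty_linearEquiv_prod (hdiv : Function.Surjective fun a : A => ℓ • a)
    (hcard : Nat.card {a : A // ℓ • a = 0} = ℓ ^ 2) :
    Nonempty (TateModule ℓ A ≃ₗ[ℤ_[ℓ]] ℤ_[ℓ] × ℤ_[ℓ]) := by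
  have hcard' : Nat.card (primePowerTorsion ℓ A 1) = ℓ ^ 2 := by
    rw [← hcard]
    refine Nat.card_congr (Equiv.subtypeEquivRight fun a => ?_)
    rw [AddSubgroup.torsionBy.nsmul_iff, pow_one]
  let _ : Module (ZMod ℓ) (primePowerTorsion ℓ A 1) :=
    AddCommGroup.zmodModule fun a => by simpa using AddSubgroup.torsionBy.nsmul a
  obtain ⟨a, b, hspan, hindep⟩ := exists_basis_of_card hcard'
  obtain ⟨e₁, rfl⟩ := component_zero_surjective hdiv a
  obtain ⟨e₂, rfl⟩ := component_zero_surjective hdiv b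
  exact ⟨(LinearEquiv.ofBijective _ ⟨coprod_toSpanSingleton_injective e₁ e₂ hindep,
    coprod_toSpanSingleton_surjective e₁ e₂ hspan⟩).symm⟩

end TateModule

/-! ### Inverse limits of products and the conclusion. -/

/-- The inverse limit of a sequence of products is the product of the inverse limits. -/
def inverseLimitProdEquiv {A B : ℕ → Type*} [∀ n, AddCommGroup (A n)] [∀ n, AddCommGroup (B n)]
    (φA : ∀ n, A (n + 1) →+ A n) (φB : ∀ n, B (n + 1) →+ B n) :
    inverseLimit (A := fun n => A n × B n) (fun n => (φA n).prodMap (φB n)) ≃+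
      inverseLimit φA × inverseLimit φB where
  toFun x := (⟨fun n => (x.1 n).1, fun n => congrArg Prod.fst (x.2 n)⟩,
    ⟨fun n => (x.1 n).2, fun n => congrArg Prod.snd (x.2 n)⟩)
  invFun y := ⟨fun n => (y.1.1 n, y.2.1 n), fun n => Prod.ext (y.1.2 n) (y.2.2 n)⟩
  map_add' _ _ := rfl

theorem mainTheorem5 :
    (∀ (E : WeierstrassCurve ℚ) [E.IsElliptic] (K : Type*) [Field K] [DecidableEq K]
        [Algebra ℚ K] [IsAlgClosed K] (ℓ : ℕ) [Fact ℓ.Prime],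
      Nonempty (TateModule ℓ (WeierstrassCurve.Affine.Point (E.baseChange K)) ≃ₗ[ℤ_[ℓ]]
        ℤ_[ℓ] × ℤ_[ℓ])) ∧
    (∀ (A B : ℕ → Type*) [∀ n, AddCommGroup (A n)] [∀ n, AddCommGroup (B n)]
        (φA : ∀ n, A (n + 1) →+ A n) (φB : ∀ n, B (n + 1) →+ B n),
      ∃ e : inverseLimit (A := fun n => A n × B n) (fun n => (φA n).prodMap (φB n)) ≃+
          inverseLimit φA × inverseLimit φB,
        ∀ x n, ((e x).1.1 n, (e x).2.1 n) = x.1 n) := by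
  refine ⟨?_, fun A B _ _ φA φB => ⟨inverseLimitProdEquiv φA φB, fun _ _ => rfl⟩⟩
  intro E _ K _ _ _ _ ℓ hℓ
  have : CharZero K := algebraRat.charZero K
  have : (E.baseChange K).IsElliptic := inferInstanceAs (E.map (algebraMap ℚ K)).IsElliptic
  exact TateModule.nonempty_linearEquiv_prod
    (WeierstrassCurve.Affine.Point.nsmul_surjective hℓ.out.ne_zero)
    (WeierstrassCurve.Affine.Point.card_nsmul_eq_zero hℓ.out.ne_zero)
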